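/- Let $p$ be a prime, let $\mathbb{Z}/p$ act continuously on a topological space $X$, and fix a generator $g$ of $\mathbb{Z}/p$. Let $E\mathbb{Z}/p=S^\infty$ carry its standard cell structure with cells $g^k\Delta_i$ ($0\le k<p$, $i\ge 0$, $\dim\Delta_i=i$) and $$d\Delta_{2k}=(1+g+\dots+g^{p-1})\Delta_{2k-1},\qquad d\Delta_{2k+1}=(g-1)\Delta_{2k},$$ and let $H^{\mathbb{Z}/p}_*(X;\mathbb{F}_p)$ be the homology of $C^{\mathrm{cell}}_*(E\mathbb{Z}/p;\mathbb{F}_p)\otimes_{\mathbb{Z}/p}C_*(X;\mathbb{F}_p)$, where $C_*$ denotes singular chains, $g\Delta\otimes x=\Delta\otimes gx$, and $d(\Delta_i\otimes x)=d\Delta_i\otimes x+(-1)^i\Delta_i\otimes\partial x$. Let $W\subset X$ be a $\mathbb{Z}/p$-invariant closed (topological) $n$-manifold, and let $U\subset W$ be a compact $n$-dimensional submanifold with boundary $\partial U=L$, such that $W=\bigcup_k g^kU$ and the interior $U\setminus L$ is disjoint from its translates $h(U\setminus L)$, $h\ne 1$. Let $W$ be given a $\mathbb{Z}/p$-invariant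 finite triangulation by (ordered) singular simplices and an invariant orientation (for $p=2$: a mod-$2$ orientation), such that $U$ is a union of $n$-simplices, and let $L$ be triangulated by the $(n-1)$-simplices of the boundary and oriented as the boundary of $U$. Write $W$, $U$, $L$ also for the corresponding mod-$p$ fundamental chains, i.e. the signed sums of the top-dimensional simplices, so that $\partial W=0$ and $\partial U=L$. Then for every $i\ge 0$ all the chains below are cycles, and in $H^{\mathbb{Z}/p}_{n+i}(X;\mathbb{F}_p)$: 1. if $i$ is odd, then $[\Delta_i\otimes W]=-[\Delta_{i+1}\otimes L]$; 2. if $i$ is even, then $[\Delta_i\otimes W]=[\Delta_{i+1}\otimes (g-1)^{p-2}L]$ (for $p=2$ this is $[\Delta_{i+1}\otimes L]$); 3. if the subset $L$ is $\mathbb{Z}/p$-invariant, then $[\Delta_i\otimes W]=(-1)^i[\Delta_{i+1}\otimes L]$ for every $i$. -/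

import Mathlib

open CategoryTheory
open scoped Pointwise

noncomputable section

namespace PartialLocalisation

universe u

/-- The standard topological `n`-simplex. -/
abbrev Simp (n : ℕ) : Type := stdSimplex ℝ (Fin (n + 1))

/-! ### Singular chains with coefficients in `𝔽_p` -/

section SingularChains

variable (p : ℕ) (X : Type u) [TopologicalSpace X]

/-- The coefficient module `𝔽_p`, lifted to the universe of the space. -/
abbrev coeff : ModuleCat.{u} (ZMod p) := ModuleCat.of (ZMod p) (ULift.{u} (ZMod p))

/-- The singular chain complex `C_*(X; 𝔽_p)`: the chain complex of the singular simplicial set. -/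
abbrev singComplex : ChainComplex (ModuleCat.{u} (ZMod p)) ℕ :=
  (TopCat.toSSet.obj (TopCat.of X)).chainComplex (coeff.{u} p)

/-- It is Mathlib's singular chain complex. -/
theorem singComplex_eq : singComplex p X =
    ((AlgebraicTopology.singularChainComplexFunctor (ModuleCat.{u} (ZMod p))).obj
      (coeff.{u} p)).obj (TopCat.of X) :=
  rfl

/-- Singular `n`-chains `C_n(X; 𝔽_p)`. -/
abbrev SingChain (n : ℕ) : Type u := (singComplex p X).X n

/-- The singular boundary `C_j(X; 𝔽_p) → C_k(X; 𝔽_p)`; it is zero unless `j = k + 1`. -/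
abbrev bd (j k : ℕ) : SingChain p X j →ₗ[ZMod p] SingChain p X k :=
  ((singComplex p X).d j k).hom

variable {X}

/-- A continuous map `σ : Δⁿ → X`, regarded as a singular `n`-chain (with coefficient `1`). -/
def simplexChain {n : ℕ} (σ : C(Simp n, X)) : SingChain p X n :=
  (SSet.ιChainComplex (R := coeff.{u} p) (TopCat.toSSet.obj (TopCat.of X))
    (((TopCat.of X).toSSetObjEquiv (.op (SimplexCategory.mk n))).symm σ)).hom ⟨1⟩

/-- The signed sum `∑_{σ ∈ T} ε(σ) σ` of a finite set of singular `n`-simplices. -/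
def signedSum {n : ℕ} (T : Finset C(Simp n, X)) (ε : C(Simp n, X) → ℤˣ) : SingChain p X n :=
  ∑ σ ∈ T, (ε σ : ℤ) • simplexChain p σ

end SingularChains

/-! ### `ℤ/p`-equivariant homology

For a generator `g` of `ℤ/p`, the space `Eℤ/p = S^∞` has the cells `gᵏ Δ_i` (`0 ≤ k < p`, `i ≥ 0`)
with `dΔ_{2k} = (1 + g + ⋯ + g^{p-1}) Δ_{2k-1}` and `dΔ_{2k+1} = (g - 1) Δ_{2k}`. So
`C_*^cell(Eℤ/p; 𝔽_p)` is free over `𝔽_p[ℤ/p]` on the `Δ_i`, and in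
`C_*^cell(Eℤ/p) ⊗_{ℤ/p} C_*(X)`, where `gΔ ⊗ x = Δ ⊗ gx`, every element of degree `m` is uniquely
`∑_{i+j=m} Δ_i ⊗ x_{i,j}` with `x_{i,j} ∈ C_j(X; 𝔽_p)`. -/

section Equivariant

variable (p : ℕ) (X : Type u) [TopologicalSpace X]
  [MulAction (Multiplicative (ZMod p)) X] [ContinuousConstSMul (Multiplicative (ZMod p)) X]
  (g : Multiplicative (ZMod p))

/-- The action of the group element `g` on singular `j`-chains. -/
def act (j : ℕ) : Module.End (ZMod p) (SingChain p X j) :=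
  ((SSet.chainComplexMap (TopCat.toSSet.map
    (TopCat.ofHom (⟨fun x : X => g • x, continuous_const_smul g⟩ : C(X, X))))
    (coeff.{u} p)).f j).hom

/-- The norm element `1 + g + ⋯ + g^{p-1}` acting on singular `j`-chains. -/
def norm (j : ℕ) : Module.End (ZMod p) (SingChain p X j) :=
  ∑ k ∈ Finset.range p, act p X g j ^ k

/-- The degree `m` part of `C_*^cell(Eℤ/p) ⊗_{ℤ/p} C_*(X)`: the family `c` stands for
`∑_{i+j=m} Δ_i ⊗ c_{i,j}`. -/
abbrev EqChain (m : ℕ) : Type u :=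
  ∀ q : {q : ℕ × ℕ // q.1 + q.2 = m}, SingChain p X q.1.2

/-- The operator `t_i` on `C_j(X)` such that `dΔ_{i+1} ⊗ x = Δ_i ⊗ t_i x`. -/
def cellBd (i j : ℕ) : Module.End (ZMod p) (SingChain p X j) :=
  if Even i then act p X g j - 1 else norm p X g j

/-- The differential `d(Δ_i ⊗ x) = dΔ_i ⊗ x + (-1)^i Δ_i ⊗ ∂x` of
`C_*^cell(Eℤ/p) ⊗_{ℤ/p} C_*(X)`, written in coefficients. -/
def eqBd (m : ℕ) : EqChain p X (m + 1) →ₗ[ZMod p] EqChain p X m :=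
  LinearMap.pi fun q =>
    (cellBd p X g q.1.1 q.1.2).comp
        (LinearMap.proj (⟨(q.1.1 + 1, q.1.2), by have := q.2; grind⟩ :
          {r : ℕ × ℕ // r.1 + r.2 = m + 1})) +
      ((-1 : ℤ) ^ q.1.1) • (bd p X (q.1.2 + 1) q.1.2).comp
        (LinearMap.proj (⟨(q.1.1, q.1.2 + 1), by have := q.2; grind⟩ :
          {r : ℕ × ℕ // r.1 + r.2 = m + 1}))

/-- Equivariant cycles. -/
def eqCycles : ∀ m : ℕ, Submodule (ZMod p) (EqChain p X m)
  | 0 => ⊤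
  | m + 1 => LinearMap.ker (eqBd p X g m)

/-- The equivariant homology `H_m^{ℤ/p}(X; 𝔽_p)`: cycles modulo boundaries. -/
abbrev EqHomology (m : ℕ) : Type u :=
  eqCycles p X g m ⧸ (LinearMap.range (eqBd p X g m)).submoduleOf (eqCycles p X g m)

variable {X}

/-- The class in `H_m^{ℤ/p}(X; 𝔽_p)` of an equivariant cycle. -/
def eqClass {m : ℕ} (c : EqChain p X m) (hc : c ∈ eqCycles p X g m) : EqHomology p X g m :=
  Submodule.Quotient.mk ⟨c, hc⟩

/-- The chain `Δ_i ⊗ c`, for `c ∈ C_j(X)`, as an equivariant chain of degree `m = i + j`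
(zero if `m ≠ i + j`). -/
def cellTensor (i j m : ℕ) (c : SingChain p X j) : EqChain p X m :=
  fun q => if h : j = q.1.2 ∧ i = q.1.1 then h.1 ▸ c else 0

end Equivariant

/-! ### Manifolds and their triangulations -/

section Manifolds

variable {X : Type u} [TopologicalSpace X]

/-- The closed half-space `{y₀ ≥ 0}` of `ℝⁿ` (a point if `n = 0`). -/
def HalfSpace (n : ℕ) : Type :=
  {y : EuclideanSpace ℝ (Fin n) // ∀ h : 0 < n, 0 ≤ y ⟨0, h⟩}

instance (n : ℕ) : TopologicalSpace (HalfSpace n) :=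
  inferInstanceAs (TopologicalSpace {y : EuclideanSpace ℝ (Fin n) // ∀ h : 0 < n, 0 ≤ y ⟨0, h⟩})

/-- The subset `M` of `X` is a compact topological `n`-manifold with boundary `B`. -/
structure IsCompactManifold (n : ℕ) (M B : Set X) : Prop where
  isCompact : IsCompact M
  t2 : T2Space M
  boundary_subset : B ⊆ M
  interior_chart : ∀ x : M, (x : X) ∉ B →
    ∃ e : OpenPartialHomeomorph M (EuclideanSpace ℝ (Fin n)), x ∈ e.source
  boundary_chart : ∀ x : M, (x : X) ∈ B →
    ∃ e : OpenPartialHomeomorph M (HalfSpace n), x ∈ e.source ∧ ∃ h : 0 < n, (e x).1 ⟨0, h⟩ = 0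

/-- The finite set `T` of embedded `n`-simplices is a cell structure on the closed `n`-manifold
`M`: the simplices cover `M`, the interior of a simplex meets no other simplex, and a point in the
relative interior of a facet lies in at most two simplices. (All this holds for the `n`-simplices
of a triangulation of `M`.) -/
structure IsTriangulation {n : ℕ} (T : Finset C(Simp n, X)) (M : Set X) : Prop where
  injective : ∀ σ ∈ T, Function.Injective σ
  cover : M = ⋃ σ ∈ T, Set.range σ
  interior_disjoint : ∀ σ ∈ T, ∀ τ ∈ T, σ ≠ τ →
    ∀ x : Simp n, (∀ k, 0 < x.1 k) → σ x ∉ Set.range τ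
  facet : ∀ σ ∈ T, ∀ x : Simp n, ∀ k, x.1 k = 0 → (∀ l, l ≠ k → 0 < x.1 l) →
    {τ | τ ∈ T ∧ σ x ∈ Set.range τ}.ncard ≤ 2

open Classical in
/-- The simplices of `T` that lie in `U`. -/
def simplicesIn {n : ℕ} (T : Finset C(Simp n, X)) (U : Set X) : Finset C(Simp n, X) :=
  T.filter fun σ => Set.range σ ⊆ U

end Manifolds

end PartialLocalisation

end

/-!
Write `N = 1 + g + ⋯ + g^{p-1}`, and `w`, `u`, `l` for the fundamental chains of `W`, `U`, `L`.

*Algebra.* If `w = N u`, then for odd `i`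
`d(Δ_{i+1} ⊗ u) = Δ_i ⊗ N u + Δ_{i+1} ⊗ ∂u = Δ_i ⊗ w + Δ_{i+1} ⊗ l`.
For even `i`, the identity `N = (g - 1)^{p-1}` in characteristic `p` (`norm_eq_sub_one_pow`) gives
`d(Δ_{i+1} ⊗ (g - 1)^{p-2} u) = Δ_i ⊗ w - Δ_{i+1} ⊗ (g - 1)^{p-2} l`.
These are `eqClass_eq_of_odd` and `eqClass_eq_of_even`.

*The fundamental chain of `W`.* The equality `w = N u` (`signedSum_eq_norm`) says that every simplex
of `W` lies in exactly one of the translates of `U`. It lies in at least one since its barycenter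
does, and the simplex of that translate which contains the barycenter can only be the simplex
itself. If it lay in two, its interior would meet `L` or a translate of `L`. No dimension theory is
needed to exclude this: singular simplices are linearly independent, so `∂u = l` forces each
simplex of `L` to be a face of a simplex of `U` (`exists_eq_face_of_bd_eq`). Hence points of `L` are
boundary points of simplices, and these are never interior points of simplices.

*Invariant `L`.* If `L` is invariant and nonempty, an interior point of a facet in `L` lies in all
`p` translates of `U`, so in `p` distinct simplices, while a facet belongs to at most two
(`card_le_two_of_smul_eq`). So `p = 2` or `l = 0`; either way `(g - 1)^{p-2} l = l`, and the third
claim follows from the other two.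
-/

namespace PartialLocalisation

universe u

/-! ### Singular chains -/

section Chains

variable (p : ℕ) {X : Type u} [TopologicalSpace X]

/-- The `j`-th face of a singular simplex. -/
noncomputable def face {n : ℕ} (σ : C(Simp (n + 1), X)) (j : Fin (n + 2)) : C(Simp n, X) :=
  σ.comp ⟨stdSimplex.map j.succAbove, stdSimplex.continuous_map _⟩

theorem bd_simplexChain {n : ℕ} (σ : C(Simp (n + 1), X)) :
    bd p X (n + 1) n (simplexChain p σ) =
      ∑ j : Fin (n + 2), (-1 : ℤ) ^ j.val • simplexChain p (face σ j) := by
  have h := SSet.ιChainComplex_d (R := coeff.{u} p) (TopCat.toSSet.obj (TopCat.of X))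
    (((TopCat.of X).toSSetObjEquiv (.op (SimplexCategory.mk (n + 1)))).symm σ)
  have h' := congrArg (fun f => f.hom ⟨1⟩) h
  simp only [ModuleCat.hom_comp, LinearMap.comp_apply, ModuleCat.hom_sum, LinearMap.sum_apply] at h'
  refine h'.trans (Finset.sum_congr rfl fun j _ => ?_)
  rfl

theorem act_simplexChain [MulAction (Multiplicative (ZMod p)) X]
    [ContinuousConstSMul (Multiplicative (ZMod p)) X] (g : Multiplicative (ZMod p)) {n : ℕ}
    (σ : C(Simp n, X)) : act p X g n (simplexChain p σ) = simplexChain p (g • σ) := by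
  have h := SSet.ι_chainComplexMap_f _ _ (R := coeff.{u} p) (f := TopCat.toSSet.map
    (TopCat.ofHom (⟨fun x : X => g • x, continuous_const_smul g⟩ : C(X, X))))
    (((TopCat.of X).toSSetObjEquiv (.op (SimplexCategory.mk n))).symm σ)
  exact congrArg (fun f => f.hom ⟨1⟩) h

/-- `∂∂ = 0`, also where one of the two boundaries leaves the range of degrees. -/
theorem bd_bd (i j k : ℕ) (c : SingChain p X i) : bd p X j k (bd p X i j c) = 0 :=
  congrArg (fun f => f.hom c) ((singComplex p X).d_comp_d i j k)

theorem bd_act [MulAction (Multiplicative (ZMod p)) X]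
    [ContinuousConstSMul (Multiplicative (ZMod p)) X] (g : Multiplicative (ZMod p)) (i j : ℕ)
    (c : SingChain p X i) : bd p X i j (act p X g i c) = act p X g j (bd p X i j c) :=
  congrArg (fun f => f.hom c) ((SSet.chainComplexMap (TopCat.toSSet.map
    (TopCat.ofHom (⟨fun x : X => g • x, continuous_const_smul g⟩ : C(X, X))))
    (coeff.{u} p)).comm i j)

open Classical in
/-- The singular simplices are linearly independent: each has a coordinate functional. -/
theorem exists_coordinate {n : ℕ} (τ : C(Simp n, X)) :
    ∃ f : SingChain p X n →ₗ[ZMod p] ULift.{u} (ZMod p),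
      ∀ σ, f (simplexChain p σ) = if σ = τ then ⟨1⟩ else 0 := by
  let S := TopCat.toSSet.obj (TopCat.of X)
  let e := (TopCat.of X).toSSetObjEquiv (.op (SimplexCategory.mk n))
  let c : Limits.Cofan fun _ : S.obj (.op (SimplexCategory.mk n)) => coeff.{u} p :=
    Limits.Cofan.mk (coeff.{u} p) fun s => if e s = τ then 𝟙 _ else 0
  refine ⟨((S.isColimitChainComplexXCofan (coeff.{u} p) n).desc c).hom, fun σ => ?_⟩
  have h := congrArg (fun f => f.hom ⟨1⟩)
    ((S.isColimitChainComplexXCofan (coeff.{u} p) n).fac c ⟨e.symm σ⟩)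
  refine h.trans ?_
  simp only [c, Limits.Cofan.mk_ι_app, Equiv.apply_symm_apply]
  split_ifs <;> rfl

end Chains

/-! ### The equivariant chain complex -/

section Algebra

variable (p : ℕ) (X : Type u) [TopologicalSpace X]
  [MulAction (Multiplicative (ZMod p)) X] [ContinuousConstSMul (Multiplicative (ZMod p)) X]
  (g : Multiplicative (ZMod p))

/-- `N = (g - 1)^{p-1}`, from the corresponding identity in `𝔽_p[X]`. -/
theorem norm_eq_sub_one_pow [hp : Fact p.Prime] (j : ℕ) :
    norm p X g j = (act p X g j - 1) ^ (p - 1) := by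
  have key : ∑ k ∈ Finset.range p, (Polynomial.X : Polynomial (ZMod p)) ^ k =
      (Polynomial.X - 1) ^ (p - 1) := by
    -- both sides times `X - 1` are `X^p - 1 = (X - 1)^p`
    have hX : (Polynomial.X - 1 : Polynomial (ZMod p)) ≠ 0 := Polynomial.X_sub_C_ne_zero 1
    refine mul_right_cancel₀ hX ?_
    rw [geom_sum_mul, ← pow_succ, Nat.sub_add_cancel hp.out.one_le, sub_pow_char, one_pow]
  simpa [norm] using congrArg (Polynomial.aeval (act p X g j)) key

variable {X}

theorem bd_sub_one_pow (i j k : ℕ) (c : SingChain p X i) :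
    bd p X i j (((act p X g i - 1) ^ k) c) = ((act p X g j - 1) ^ k) (bd p X i j c) := by
  induction k with
  | zero => rfl
  | succ k ih =>
    rw [pow_succ', pow_succ', Module.End.mul_apply, Module.End.mul_apply, ← ih]
    simp [bd_act]

/-- A chain `Δ_i ⊗ c` is a cycle as soon as both parts of its differential vanish. -/
theorem cellTensor_mem_eqCycles {i j m : ℕ} {c : SingChain p X j} (hc : bd p X j (j - 1) c = 0)
    (ht : ∀ a, i = a + 1 → cellBd p X g a j c = 0) :
    cellTensor p i j m c ∈ eqCycles p X g m := by
  cases m with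
  | zero => trivial
  | succ m =>
    refine LinearMap.mem_ker.2 (funext fun ⟨⟨a, b⟩, hab⟩ => ?_)
    have h₁ : cellBd p X g a b (cellTensor p i j (m + 1) c ⟨(a + 1, b), by grind⟩) = 0 := by
      by_cases h : j = b ∧ i = a + 1
      · obtain ⟨rfl, rfl⟩ := h
        simpa [cellTensor] using ht a rfl
      · rw [cellTensor, dif_neg h, map_zero]
    have h₂ : bd p X (b + 1) b (cellTensor p i j (m + 1) c ⟨(a, b + 1), by grind⟩) = 0 := by
      by_cases h : j = b + 1 ∧ i = a
      · obtain ⟨rfl, rfl⟩ := h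
        simpa [cellTensor] using hc
      · rw [cellTensor, dif_neg h, map_zero]
    simp only [eqBd, LinearMap.pi_apply, LinearMap.add_apply, LinearMap.comp_apply,
      LinearMap.proj_apply, LinearMap.smul_apply, Pi.zero_apply]
    rw [h₁, h₂, smul_zero, add_zero]

/-- `d(Δ_{i+1} ⊗ c) = Δ_i ⊗ t_i c + (-1)^{i+1} Δ_{i+1} ⊗ ∂c`. For `j = 0` the last term
is zero for reasons of degree. -/
theorem eqBd_cellTensor (i j : ℕ) (c : SingChain p X j) :
    eqBd p X g (i + j) (cellTensor p (i + 1) j (i + j + 1) c) =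
      cellTensor p i j (i + j) (cellBd p X g i j c) +
        (-1 : ℤ) ^ (i + 1) • cellTensor p (i + 1) (j - 1) (i + j) (bd p X j (j - 1) c) := by
  refine funext fun ⟨⟨a, b⟩, hab⟩ => ?_
  have h₁ : cellBd p X g a b (cellTensor p (i + 1) j (i + j + 1) c ⟨(a + 1, b), by grind⟩) =
      cellTensor p i j (i + j) (cellBd p X g i j c) ⟨(a, b), hab⟩ := by
    unfold cellTensor
    by_cases h : j = b ∧ i = a
    · obtain ⟨rfl, rfl⟩ := h
      simp
    · rw [dif_neg (by simpa using h), dif_neg h, map_zero]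
  have h₂ : (-1 : ℤ) ^ a •
        bd p X (b + 1) b (cellTensor p (i + 1) j (i + j + 1) c ⟨(a, b + 1), by grind⟩) =
      (-1 : ℤ) ^ (i + 1) •
        cellTensor p (i + 1) (j - 1) (i + j) (bd p X j (j - 1) c) ⟨(a, b), hab⟩ := by
    unfold cellTensor
    by_cases h : j = b + 1 ∧ i + 1 = a
    · obtain ⟨rfl, rfl⟩ := h
      simp
    · have h' : ¬ (j - 1 = b ∧ i + 1 = a) := by
        rintro ⟨rfl, rfl⟩
        simp only at hab
        omega
      rw [dif_neg h, dif_neg h', map_zero, smul_zero, smul_zero]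
  simp only [eqBd, LinearMap.pi_apply, LinearMap.add_apply, LinearMap.comp_apply,
    LinearMap.proj_apply, LinearMap.smul_apply, Pi.add_apply, Pi.smul_apply]
  rw [h₁, h₂]

theorem eqClass_eq_zsmul_eqClass {m : ℕ} {a b : EqChain p X m} (ha : a ∈ eqCycles p X g m)
    (hb : b ∈ eqCycles p X g m) (z : ℤ) (c : EqChain p X (m + 1))
    (h : eqBd p X g m c = a - z • b) : eqClass p g a ha = z • eqClass p g b hb := by
  refine Eq.trans ?_ (map_zsmul (Submodule.mkQ _) z (⟨b, hb⟩ : eqCycles p X g m))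
  exact (Submodule.Quotient.eq _).2 ⟨c, h⟩

end Algebra

/-! ### Points of simplices, and faces in a boundary -/

section Geometry

theorem exists_interior_point (n : ℕ) : ∃ x : Simp n, ∀ k, 0 < x.1 k :=
  ⟨stdSimplex.barycenter, fun k => by
    change (0 : ℝ) < (Fintype.card (Fin (n + 1)) : ℝ)⁻¹
    positivity⟩

theorem map_succAbove_self {n : ℕ} (j : Fin (n + 2)) (x : Simp n) :
    (stdSimplex.map (S := ℝ) j.succAbove x).1 j = 0 := by
  change FunOnFinite.linearMap ℝ ℝ j.succAbove x j = 0
  rw [FunOnFinite.linearMap_apply_apply]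
  refine Finset.sum_eq_zero fun k hk => ?_
  exact absurd (Finset.mem_filter.1 hk).2 (Fin.succAbove_ne j k)

theorem map_succAbove_succAbove {n : ℕ} (j : Fin (n + 2)) (x : Simp n) (k : Fin (n + 1)) :
    (stdSimplex.map (S := ℝ) j.succAbove x).1 (j.succAbove k) = x.1 k := by
  change FunOnFinite.linearMap ℝ ℝ j.succAbove x (j.succAbove k) = x k
  simp [FunOnFinite.linearMap_apply_apply, Finset.filter_eq']

variable {X : Type u} [TopologicalSpace X] {n : ℕ} {T : Finset C(Simp n, X)} {W U : Set X}

theorem mem_simplicesIn {σ : C(Simp n, X)} :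
    σ ∈ simplicesIn T U ↔ σ ∈ T ∧ Set.range σ ⊆ U := by
  simp [simplicesIn]

/-- The interior of a simplex of a triangulation misses the boundary of every simplex. -/
theorem IsTriangulation.interior_ne_boundary (hT : IsTriangulation T W) {σ τ : C(Simp n, X)}
    (hσ : σ ∈ T) (hτ : τ ∈ T) {x y : Simp n} (hx : ∀ k, 0 < x.1 k) {k : Fin (n + 1)}
    (hy : y.1 k = 0) : σ x ≠ τ y := by
  intro h
  by_cases hστ : σ = τ
  · subst hστ
    have := hT.injective σ hσ h
    subst this
    exact (hx k).ne' hy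
  · exact hT.interior_disjoint σ hσ τ hτ hστ x hx ⟨y, h.symm⟩

variable (p : ℕ) [Fact p.Prime] {S : Finset C(Simp n, X)} {TL : Finset C(Simp (n - 1), X)}
  {ε : C(Simp n, X) → ℤˣ} {εL : C(Simp (n - 1), X) → ℤˣ} {L : Set X}

open Classical in
theorem coordinate_signedSum_ne_zero {τ : C(Simp n, X)} (hτ : τ ∈ T)
    {f : SingChain p X n →ₗ[ZMod p] ULift.{u} (ZMod p)}
    (hf : ∀ σ, f (simplexChain p σ) = if σ = τ then ⟨1⟩ else 0) : f (signedSum p T ε) ≠ 0 := by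
  simp only [signedSum, map_sum, map_zsmul, hf, smul_ite, smul_zero, Finset.sum_ite_eq', hτ,
    if_true]
  intro h
  rcases Int.units_eq_one_or (ε τ) with h' | h' <;> rw [h'] at h <;>
    simpa using congrArg ULift.down h

theorem eq_empty_of_signedSum_eq_zero (h : signedSum p T ε = 0) : T = ∅ := by
  refine Finset.eq_empty_of_forall_notMem fun τ hτ => ?_
  obtain ⟨f, hf⟩ := exists_coordinate p τ
  exact coordinate_signedSum_ne_zero p hτ hf (h ▸ map_zero f)

/-- The signs `±1` are nonzero mod `p`, so all simplices of the right-hand side do occur in the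
boundary on the left. -/
theorem exists_eq_face_of_bd_eq {m : ℕ} {S : Finset C(Simp (m + 1), X)}
    {TL : Finset C(Simp m, X)} {ε : C(Simp (m + 1), X) → ℤˣ} {εL : C(Simp m, X) → ℤˣ}
    (hbd : bd p X (m + 1) m (signedSum p S ε) = signedSum p TL εL)
    {τ : C(Simp m, X)} (hτ : τ ∈ TL) : ∃ σ ∈ S, ∃ j, face σ j = τ := by
  obtain ⟨f, hf⟩ := exists_coordinate p τ
  by_contra! hno
  refine coordinate_signedSum_ne_zero p hτ hf (ε := εL) ?_
  rw [← hbd]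
  simp only [signedSum, map_sum, map_zsmul, bd_simplexChain, hf]
  refine Finset.sum_eq_zero fun σ hσ => ?_
  simp [hno σ hσ]

/-- For `n = 0` there is no boundary, so `L` is empty. -/
theorem exists_eq_boundary_point (hTL : IsTriangulation TL L)
    (hbd : bd p X n (n - 1) (signedSum p S ε) = signedSum p TL εL) {z : X} (hz : z ∈ L) :
    ∃ σ ∈ S, ∃ y : Simp n, ∃ k, y.1 k = 0 ∧ σ y = z := by
  rw [hTL.cover] at hz
  simp only [Set.mem_iUnion, Set.mem_range] at hz
  obtain ⟨τ, hτ, x, rfl⟩ := hz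
  cases n with
  | zero =>
    have h0 : bd p X 0 (0 - 1) = 0 :=
      congrArg ModuleCat.Hom.hom ((singComplex p X).shape 0 0 (by simp))
    rw [h0, LinearMap.zero_apply] at hbd
    rw [eq_empty_of_signedSum_eq_zero p hbd.symm] at hτ
    exact absurd hτ (Finset.notMem_empty τ)
  | succ m =>
    obtain ⟨σ, hσ, j, rfl⟩ := exists_eq_face_of_bd_eq p hbd hτ
    exact ⟨σ, hσ, _, j, map_succAbove_self j x, rfl⟩

theorem exists_facet_point_mem (hTL : IsTriangulation TL L)
    (hbd : bd p X n (n - 1) (signedSum p S ε) = signedSum p TL εL) (hne : TL.Nonempty) :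
    ∃ σ ∈ S, ∃ y : Simp n, ∃ k, y.1 k = 0 ∧ (∀ l, l ≠ k → 0 < y.1 l) ∧ σ y ∈ L := by
  obtain ⟨τ, hτ⟩ := hne
  obtain ⟨x, hx⟩ := exists_interior_point (n - 1)
  have hxL : τ x ∈ L := by
    rw [hTL.cover]
    exact Set.mem_biUnion hτ ⟨x, rfl⟩
  cases n with
  | zero =>
    obtain ⟨σ, -, y, k, hk, -⟩ := exists_eq_boundary_point p hTL hbd hxL
    have hy : y.1 0 = 1 := by simpa using y.2.2
    rw [show k = 0 by omega, hy] at hk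
    exact absurd hk one_ne_zero
  | succ m =>
    obtain ⟨σ, hσ, j, rfl⟩ := exists_eq_face_of_bd_eq p hbd hτ
    refine ⟨σ, hσ, _, j, map_succAbove_self j x, fun l hl => ?_, hxL⟩
    obtain ⟨k, rfl⟩ := Fin.exists_succAbove_eq hl
    exact (hx k).trans_eq (map_succAbove_succAbove j x k).symm

end Geometry

/-! ### Tilings by translates -/

section Tiling

variable {G : Type*} [Group G] {X : Type u} [TopologicalSpace X] [MulAction G X]
  [ContinuousConstSMul G X] {n : ℕ} {T : Finset C(Simp n, X)} {W U L : Set X}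

/-- Distinct translates of `U` have no simplex in common: the interior of such a simplex would
lie in `L` or in its translate, but `L` consists of boundary points of simplices. -/
theorem eq_one_of_smul_mem_simplicesIn (hT : IsTriangulation T W)
    (hdisj : ∀ h : G, h ≠ 1 → Disjoint (U \ L) (h • (U \ L)))
    (hL : ∀ z ∈ L, ∃ σ ∈ simplicesIn T U, ∃ y : Simp n, ∃ k, y.1 k = 0 ∧ σ y = z)
    {h : G} {τ : C(Simp n, X)} (hτ : τ ∈ simplicesIn T U) (hhτ : h • τ ∈ simplicesIn T U) :
    h = 1 := by
  by_contra hh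
  obtain ⟨x, hx⟩ := exists_interior_point n
  have key : ∀ σ ∈ simplicesIn T U, σ x ∈ U \ L := by
    refine fun σ hσ => ⟨(mem_simplicesIn.1 hσ).2 ⟨x, rfl⟩, fun hxL => ?_⟩
    obtain ⟨ρ, hρ, y, k, hk, hy⟩ := hL _ hxL
    exact hT.interior_ne_boundary (mem_simplicesIn.1 hσ).1 (mem_simplicesIn.1 hρ).1 hx hk hy.symm
  exact Set.disjoint_left.1 (hdisj h hh) (key _ hhτ) (Set.smul_mem_smul_set (key _ hτ))

/-- A simplex of a triangulation of `W = ⋃ gᵏ U` lies in one of the sets `gᵏ U`, since its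
barycenter does. -/
theorem exists_pow_smul_eq (hT : IsTriangulation T W) (hTinv : ∀ h : G, ∀ σ ∈ T, h • σ ∈ T)
    {g : G} (hcover : W = ⋃ k : ℕ, g ^ k • U)
    (hTU : U = ⋃ σ ∈ simplicesIn T U, Set.range σ) {σ : C(Simp n, X)} (hσ : σ ∈ T) :
    ∃ k : ℕ, ∃ τ ∈ simplicesIn T U, g ^ k • τ = σ := by
  obtain ⟨x, hx⟩ := exists_interior_point n
  have hxW : σ x ∈ W := by
    rw [hT.cover]
    exact Set.mem_biUnion hσ ⟨x, rfl⟩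
  rw [hcover] at hxW
  obtain ⟨k, z, hz, hzx⟩ := Set.mem_iUnion.1 hxW
  rw [hTU] at hz
  simp only [Set.mem_iUnion, Set.mem_range] at hz
  obtain ⟨τ, hτ, y, rfl⟩ := hz
  refine ⟨k, τ, hτ, ?_⟩
  by_contra hne
  exact hT.interior_disjoint σ hσ _ (hTinv _ τ (mem_simplicesIn.1 hτ).1) (Ne.symm hne) x hx
    ⟨y, hzx⟩

/-- If `L` is invariant, a relative interior point of a facet in `L` lies in a simplex of each
translate of `U`. These simplices are distinct, and there are at most two of them. -/
theorem card_le_two_of_smul_eq [Fintype G] (hT : IsTriangulation T W)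
    (hTinv : ∀ h : G, ∀ σ ∈ T, h • σ ∈ T)
    (hdisj : ∀ h : G, h ≠ 1 → Disjoint (U \ L) (h • (U \ L)))
    (hTU : U = ⋃ σ ∈ simplicesIn T U, Set.range σ) (hLU : L ⊆ U) (hLinv : ∀ h : G, h • L = L)
    (hL : ∀ z ∈ L, ∃ σ ∈ simplicesIn T U, ∃ y : Simp n, ∃ k, y.1 k = 0 ∧ σ y = z)
    {σ : C(Simp n, X)} (hσ : σ ∈ T) {y : Simp n} {k : Fin (n + 1)} (hk : y.1 k = 0)
    (hy : ∀ l, l ≠ k → 0 < y.1 l) (hyL : σ y ∈ L) : Fintype.card G ≤ 2 := by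
  have hex : ∀ h : G, ∃ τ ∈ simplicesIn T U, σ y ∈ Set.range (h • τ) := by
    intro h
    rw [← hLinv h] at hyL
    obtain ⟨z, hz, hzy⟩ := hyL
    have hzU := hLU hz
    rw [hTU] at hzU
    simp only [Set.mem_iUnion, Set.mem_range] at hzU
    obtain ⟨τ, hτ, x, rfl⟩ := hzU
    exact ⟨τ, hτ, x, hzy⟩
  choose τ hτ hτy using hex
  have hinj : Function.Injective fun h : G => h • τ h := by
    intro h h' hh
    simp only at hh
    refine (inv_mul_eq_one.1 (eq_one_of_smul_mem_simplicesIn hT hdisj hL (hτ h') ?_))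
    rw [mul_smul, ← hh, inv_smul_smul]
    exact hτ h
  refine le_trans ?_ (hT.facet σ hσ y k hk hy)
  rw [← Nat.card_eq_fintype_card, ← Set.ncard_univ, ← Set.ncard_image_of_injective _ hinj]
  refine Set.ncard_le_ncard ?_ (T.finite_toSet.subset fun ρ hρ => hρ.1)
  rintro _ ⟨h, -, rfl⟩
  exact ⟨hTinv h _ (mem_simplicesIn.1 (hτ h)).1, hτy h⟩

end Tiling

/-! ### The fundamental chain as a norm -/

section FundamentalChain

variable (p : ℕ) [Fact p.Prime] {X : Type u} [TopologicalSpace X]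
  [MulAction (Multiplicative (ZMod p)) X] [ContinuousConstSMul (Multiplicative (ZMod p)) X]
  {g : Multiplicative (ZMod p)} {n : ℕ} {T : Finset C(Simp n, X)} {ε : C(Simp n, X) → ℤˣ}
  {W U L : Set X}

theorem act_pow_simplexChain (k : ℕ) (σ : C(Simp n, X)) :
    (act p X g n ^ k) (simplexChain p σ) = simplexChain p (g ^ k • σ) := by
  induction k with
  | zero => simp
  | succ k ih => rw [pow_succ', Module.End.mul_apply, ih, act_simplexChain, smul_smul, ← pow_succ']

theorem act_signedSum
    (hTinv : ∀ h : Multiplicative (ZMod p), ∀ σ ∈ T, h • σ ∈ T ∧ ε (h • σ) = ε σ) :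
    act p X g n (signedSum p T ε) = signedSum p T ε := by
  simp only [signedSum, map_sum, map_zsmul, act_simplexChain]
  refine Finset.sum_bij' (fun σ _ => g • σ) (fun σ _ => g⁻¹ • σ) (fun σ hσ => (hTinv g σ hσ).1)
    (fun σ hσ => (hTinv g⁻¹ σ hσ).1) (by simp) (by simp) fun σ hσ => ?_
  rw [(hTinv g σ hσ).2]

/-- The fundamental chain of `W` is the norm of that of `U`, because every simplex of `W` is
`gᵏ τ` for a unique `k < p` and a unique simplex `τ` of `U`. -/
theorem signedSum_eq_norm (hg : g ≠ 1) (hT : IsTriangulation T W)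
    (hTinv : ∀ h : Multiplicative (ZMod p), ∀ σ ∈ T, h • σ ∈ T ∧ ε (h • σ) = ε σ)
    (hcover : W = ⋃ k : ℕ, g ^ k • U)
    (hdisj : ∀ h : Multiplicative (ZMod p), h ≠ 1 → Disjoint (U \ L) (h • (U \ L)))
    (hTU : U = ⋃ σ ∈ simplicesIn T U, Set.range σ)
    (hL : ∀ z ∈ L, ∃ σ ∈ simplicesIn T U, ∃ y : Simp n, ∃ k, y.1 k = 0 ∧ σ y = z) :
    signedSum p T ε = norm p X g n (signedSum p (simplicesIn T U) ε) := by
  have hord : orderOf g = p := orderOf_eq_prime (by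
    simpa [ZMod.card] using pow_card_eq_one (x := g)) hg
  simp only [norm, signedSum, LinearMap.sum_apply]
  simp only [map_sum, map_zsmul, act_pow_simplexChain]
  rw [← Finset.sum_product']
  symm
  refine Finset.sum_bij (fun q _ => g ^ q.1 • q.2) ?_ ?_ ?_ ?_
  · rintro ⟨k, τ⟩ h
    exact (hTinv _ τ (mem_simplicesIn.1 (Finset.mem_product.1 h).2).1).1
  · rintro ⟨k, τ⟩ h ⟨k', τ'⟩ h' heq
    simp only [Finset.mem_product, Finset.mem_range] at h h' heq
    have hpow : g ^ k = g ^ k' := by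
      refine (inv_mul_eq_one.1 (eq_one_of_smul_mem_simplicesIn hT hdisj hL h'.2 ?_))
      rw [mul_smul, ← heq, inv_smul_smul]
      exact h.2
    have hk : k = k' := pow_injOn_Iio_orderOf (by simpa [hord] using h.1)
      (by simpa [hord] using h'.1) hpow
    subst hk
    rw [smul_left_cancel _ heq]
  · intro σ hσ
    obtain ⟨k, τ, hτ, rfl⟩ :=
      exists_pow_smul_eq hT (fun h σ hσ => (hTinv h σ hσ).1) hcover hTU hσ
    refine ⟨(k % p, τ), ?_, ?_⟩
    · exact Finset.mem_product.2 ⟨Finset.mem_range.2 (Nat.mod_lt _ (Fact.out : p.Prime).pos), hτ⟩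
    · change g ^ (k % p) • τ = _
      rw [← pow_mod_orderOf g k, hord]
  · rintro ⟨k, τ⟩ h
    rw [(hTinv _ τ (mem_simplicesIn.1 (Finset.mem_product.1 h).2).1).2]

end FundamentalChain

/-! ### Comparison of classes -/

section Classes

variable (p : ℕ) [hp : Fact p.Prime] {X : Type u} [TopologicalSpace X]
  [MulAction (Multiplicative (ZMod p)) X] [ContinuousConstSMul (Multiplicative (ZMod p)) X]
  {g : Multiplicative (ZMod p)} {n : ℕ} {w u : SingChain p X n} {l : SingChain p X (n - 1)}

theorem eqClass_eq_of_odd (hw : w = norm p X g n u) (hgw : act p X g n w = w)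
    (hdw : bd p X n (n - 1) w = 0) (hdu : bd p X n (n - 1) u = l) {i : ℕ} (hi : Odd i) :
    ∃ (hw : cellTensor p i n (i + n) w ∈ eqCycles p X g (i + n))
      (hl : cellTensor p (i + 1) (n - 1) (i + n) l ∈ eqCycles p X g (i + n)),
      eqClass p g _ hw = (-1 : ℤ) • eqClass p g _ hl := by
  refine ⟨cellTensor_mem_eqCycles p g hdw fun a ha => ?_,
    cellTensor_mem_eqCycles p g (hdu ▸ bd_bd p _ _ _ u) fun a ha => ?_,
    eqClass_eq_zsmul_eqClass p g _ _ _ (cellTensor p (i + 1) n (i + n + 1) u) ?_⟩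
  · have : Even a := by grind
    simp [cellBd, this, hgw]
  · obtain rfl : i = a := by omega
    rw [cellBd, if_neg (Nat.not_even_iff_odd.2 hi), norm_eq_sub_one_pow, ← hdu, ← bd_sub_one_pow,
      ← norm_eq_sub_one_pow, ← hw, hdw]
  · rw [eqBd_cellTensor, cellBd, if_neg (Nat.not_even_iff_odd.2 hi), ← hw, hdu, hi.add_one.neg_pow]
    simp

theorem eqClass_eq_of_even (hw : w = norm p X g n u) (hgw : act p X g n w = w)
    (hdw : bd p X n (n - 1) w = 0) (hdu : bd p X n (n - 1) u = l) {i : ℕ} (hi : Even i) :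
    ∃ (hw : cellTensor p i n (i + n) w ∈ eqCycles p X g (i + n))
      (hl : cellTensor p (i + 1) (n - 1) (i + n) (((act p X g (n - 1) - 1) ^ (p - 2)) l) ∈
        eqCycles p X g (i + n)),
      eqClass p g _ hw = (1 : ℤ) • eqClass p g _ hl := by
  -- `(g - 1) (g - 1)^{p-2} = (g - 1)^{p-1}` is the norm
  have hnorm : ∀ j, (act p X g j - 1) * (act p X g j - 1) ^ (p - 2) = norm p X g j := fun j => by
    rw [norm_eq_sub_one_pow, ← pow_succ', show p - 2 + 1 = p - 1 by have := hp.out.two_le; omega]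
  refine ⟨cellTensor_mem_eqCycles p g hdw fun a ha => ?_,
    cellTensor_mem_eqCycles p g ?_ fun a ha => ?_,
    eqClass_eq_zsmul_eqClass p g _ _ _
      (cellTensor p (i + 1) n (i + n + 1) (((act p X g n - 1) ^ (p - 2)) u)) ?_⟩
  · have : ¬ Even a := by grind
    rw [cellBd, if_neg this, ← hnorm, ((Commute.refl _).pow_right _).eq, Module.End.mul_apply,
      LinearMap.sub_apply, Module.End.one_apply, hgw, sub_self, map_zero]
  · rw [bd_sub_one_pow, ← hdu, bd_bd, map_zero]
  · obtain rfl : i = a := by omega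
    rw [cellBd, if_pos hi, ← Module.End.mul_apply, hnorm, norm_eq_sub_one_pow, ← hdu,
      ← bd_sub_one_pow, ← norm_eq_sub_one_pow, ← hw, hdw]
  · rw [eqBd_cellTensor, cellBd, if_pos hi, ← Module.End.mul_apply, hnorm, ← hw, bd_sub_one_pow,
      hdu, hi.add_one.neg_pow]
    simp [sub_eq_add_neg]

end Classes

end PartialLocalisation

open PartialLocalisation in
theorem mainTheorem5 (p : ℕ) [Fact p.Prime] {X : Type*} [TopologicalSpace X]
    [MulAction (Multiplicative (ZMod p)) X] [ContinuousConstSMul (Multiplicative (ZMod p)) X]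
    -- a generator of the group
    (g : Multiplicative (ZMod p)) (hg : g ≠ 1)
    -- `W` is an invariant closed `n`-manifold, tiled by the translates of `U`, where `∂U = L`
    (n : ℕ) (W U L : Set X)
    (hW : IsCompactManifold n W ∅)
    (hWinv : ∀ h : Multiplicative (ZMod p), h • W = W)
    (hUW : U ⊆ W)
    (hU : IsCompactManifold n U L)
    (hcover : W = ⋃ k : ℕ, g ^ k • U)
    (hdisj : ∀ h : Multiplicative (ZMod p), h ≠ 1 → Disjoint (U \ L) (h • (U \ L)))
    -- an invariant triangulation of `W` with an invariant orientation
    (T : Finset C(Simp n, X)) (ε : C(Simp n, X) → ℤˣ)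
    (hT : IsTriangulation T W)
    (hTinv : ∀ h : Multiplicative (ZMod p), ∀ σ ∈ T, h • σ ∈ T ∧ ε (h • σ) = ε σ)
    (hor : bd p X n (n - 1) (signedSum p T ε) = 0)
    -- `U` is a union of simplices, and `L` is triangulated and oriented as the boundary of `U`
    (hTU : U = ⋃ σ ∈ simplicesIn T U, Set.range σ)
    (TL : Finset C(Simp (n - 1), X)) (εL : C(Simp (n - 1), X) → ℤˣ)
    (hTL : IsTriangulation TL L)
    (hbd : bd p X n (n - 1) (signedSum p (simplicesIn T U) ε) = signedSum p TL εL)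
    (i : ℕ) :
    -- `[Δ_i ⊗ W] = -[Δ_{i+1} ⊗ L]` for odd `i`
    (Odd i →
      ∃ (hw : cellTensor p i n (i + n) (signedSum p T ε) ∈ eqCycles p X g (i + n))
        (hl : cellTensor p (i + 1) (n - 1) (i + n) (signedSum p TL εL) ∈
          eqCycles p X g (i + n)),
        eqClass p g _ hw = -eqClass p g _ hl) ∧
    -- `[Δ_i ⊗ W] = [Δ_{i+1} ⊗ (g - 1)^{p-2} L]` for even `i`
    (Even i →
      ∃ (hw : cellTensor p i n (i + n) (signedSum p T ε) ∈ eqCycles p X g (i + n))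
        (hl : cellTensor p (i + 1) (n - 1) (i + n)
            (((act p X g (n - 1) - 1) ^ (p - 2)) (signedSum p TL εL)) ∈
          eqCycles p X g (i + n)),
        eqClass p g _ hw = eqClass p g _ hl) ∧
    -- `[Δ_i ⊗ W] = ± [Δ_{i+1} ⊗ L]` for every `i` if `L` is invariant
    ((∀ h : Multiplicative (ZMod p), h • L = L) →
      ∃ (hw : cellTensor p i n (i + n) (signedSum p T ε) ∈ eqCycles p X g (i + n))
        (hl : cellTensor p (i + 1) (n - 1) (i + n) (signedSum p TL εL) ∈
          eqCycles p X g (i + n)),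
        eqClass p g _ hw = ((-1 : ℤ) ^ i) • eqClass p g _ hl) := by
  have hL : ∀ z ∈ L, ∃ σ ∈ simplicesIn T U, ∃ y : Simp n, ∃ k, y.1 k = 0 ∧ σ y = z :=
    fun z hz => exists_eq_boundary_point p hTL hbd hz
  have hw := signedSum_eq_norm p hg hT hTinv hcover hdisj hTU hL
  have hgw := act_signedSum p (g := g) hTinv
  have hodd := fun hi : Odd i => eqClass_eq_of_odd p hw hgw hor hbd hi
  have heven := fun hi : Even i => eqClass_eq_of_even p hw hgw hor hbd hi
  refine ⟨fun hi => ?_, fun hi => ?_, fun hLinv => ?_⟩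
  · simpa only [neg_one_zsmul] using hodd hi
  · simpa only [one_zsmul] using heven hi
  rcases Nat.even_or_odd i with hi | hi
  · rw [hi.neg_one_pow]
    -- either `p = 2`, or `L` is empty; in both cases `(g - 1)^{p-2}` fixes the chain `L`
    have hfix : ((act p X g (n - 1) - 1) ^ (p - 2)) (signedSum p TL εL) = signedSum p TL εL := by
      rcases TL.eq_empty_or_nonempty with rfl | hne
      · simp [signedSum]
      · obtain ⟨σ, hσ, y, k, hk, hy, hyL⟩ := exists_facet_point_mem p hTL hbd hne
        have hp := card_le_two_of_smul_eq hT (fun h σ hσ => (hTinv h σ hσ).1) hdisj hTU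
          hU.boundary_subset hLinv hL (mem_simplicesIn.1 hσ).1 hk hy hyL
        rw [Fintype.card_multiplicative, ZMod.card] at hp
        rw [Nat.sub_eq_zero_of_le hp, pow_zero, Module.End.one_apply]
    have h := heven hi
    rw [hfix] at h
    exact h
  · rw [hi.neg_one_pow]
    exact hodd hi
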